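/- For a matrix $M$ with real or complex entries let $s_1(M)\ge s_2(M)\ge\cdots\ge 0$ denote its singular values (the square roots of the eigenvalues of $M^HM$) in decreasing order with multiplicity, followed by zeros, so that $s_i(M)=0$ for $i>\operatorname{rank} M$. For an integer $n\ge 0$ let $S(M)=(s_1(M),\dots,s_n(M))$, i.e. zeros are appended or removed to bring the vectors of singular values to the common size $n$. For nonnegative decreasing $n$-vectors $x,y,z$, the relation $\log x-\log y\prec\log z$ means that $$\prod_{j=1}^k x_{i_j}\le\prod_{j=1}^k z_j\,y_{i_j}\qquad\text{for all } 1\le k\le n \text{ and all } 1\le i_1<\cdots<i_k\le n,$$ and that equality holds for $k=n$, i.e. $\prod_{j=1}^n x_j=\prod_{j=1}^n z_jy_j$. **Theorem.** Let $A$, $B$, $C$ be arbitrary real or complex matrices of sizes $p\times q$, $q\times r$, $r\times s$, and let $n\ge\max\{q,r\}$. Then $$\log S(ABC)-\log S(B)\prec\log\bigl(S(A)\,S(C)\bigr),$$ where $S(A)S(C)$ is the entrywise product. -/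

import Mathlib

/-- The vector `S(M)` of the first `n` singular values of a (rectangular) matrix `M`, in decreasing
order and with multiplicity, where zeros are appended once the singular values are exhausted.
The singular values are the square roots of the eigenvalues of `Mᴴ M`. -/
noncomputable def paddedSingularValues {𝕜 : Type*} [RCLike 𝕜] {p q : ℕ}
    (M : Matrix (Fin p) (Fin q) 𝕜) (n : ℕ) : Fin n → ℝ :=
  fun i => (Matrix.toEuclideanLin M).singularValues i

theorem paddedSingularValues_nonneg {𝕜 : Type*} [RCLike 𝕜] {p q : ℕ}
    (M : Matrix (Fin p) (Fin q) 𝕜) (n : ℕ) (i : Fin n) : 0 ≤ paddedSingularValues M n i :=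
  LinearMap.singularValues_nonneg _ _

theorem paddedSingularValues_antitone {𝕜 : Type*} [RCLike 𝕜] {p q : ℕ}
    (M : Matrix (Fin p) (Fin q) 𝕜) (n : ℕ) : Antitone (paddedSingularValues M n) :=
  fun _ _ h => LinearMap.singularValues_antitone _ h

/-- `log x - log y ≺_w log z` for nonnegative decreasing `n`-vectors, written multiplicatively so
that zero entries are allowed: for all `1 ≤ k ≤ n` and all `i_1 < ⋯ < i_k`,
`∏_{j ≤ k} x_{i_j} ≤ ∏_{j ≤ k} z_j y_{i_j}`. -/
def LogSubWeaklyMajorized {n : ℕ} (x y z : Fin n → ℝ) : Prop :=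
  ∀ (k : ℕ) (_ : 1 ≤ k) (hkn : k ≤ n) (i : Fin k → Fin n), StrictMono i →
    ∏ j, x (i j) ≤ ∏ j, z (Fin.castLE hkn j) * y (i j)

/-- `log x - log y ≺ log z` for nonnegative decreasing `n`-vectors: the weak relation, with
equality of the full products (the case `k = n`). -/
def LogSubMajorized {n : ℕ} (x y z : Fin n → ℝ) : Prop :=
  LogSubWeaklyMajorized x y z ∧ ∏ j, x j = ∏ j, z j * y j

/-!
The inequality follows from the Gel'fand–Naimark inequality
`∏_{i ∈ I} s_i (T S) ≤ ∏_{j < #I} s_j (T) * ∏_{i ∈ I} s_i (S)`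
(`LinearMap.prod_singularValues_comp_le`), applied once to `A` and `B C` and once to `Cᴴ` and `Bᴴ`.

Its proof is the multiplicative form of the Li–Mathias proof of Lidskii's theorem. If `T` and `S`
are invertible and every `s_i (T)` is at least `t`, then each ratio `s_i (T S) / (t s_i (S))` is at
least `1`, so the product of the ratios over `I` is at most the product over all indices. The latter
is `|det T| / t ^ n`, and it equals `∏_{j < #I} s_j (T) / t ^ #I` when `s_j (T) = t` for `j ≥ #I`.
To reach this situation for arbitrary rectangular maps, `T` and `S†` are replaced by endomorphisms
of the middle space that dominate them in norm and whose singular values are those of `T` and `S`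
raised to positive levels (`LinearMap.exists_endomorphism_singularValues_eq_max`). Domination in
norm increases all singular values, by the Courant–Fischer principle. The levels then tend to
`s_{#I - 1} (T)` and `0`.

Equality of the full products is multiplicativity of the determinant when `B` is square of size `n`
(`LinearMap.prod_singularValues_comp`); here too `A` and `Cᴴ` are first replaced by endomorphisms,
now with the same norms. If `B` is not of size `n × n`, both products vanish.
-/

open Module InnerProductSpace

namespace LinearMap

section

variable {𝕜 : Type*} [RCLike 𝕜]
  {E : Type*} [NormedAddCommGroup E] [InnerProductSpace 𝕜 E]
  {F : Type*} [NormedAddCommGroup F] [InnerProductSpace 𝕜 F]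
  {G : Type*} [NormedAddCommGroup G] [InnerProductSpace 𝕜 G]

/-! ### The max-min principle for singular values -/

/-- `T.NormDiagonalizedBy b w` says that `x ↦ ‖T x‖ ^ 2` is the diagonal quadratic form with
coefficients `w i ^ 2` in the orthonormal basis `b`. When `w` is nonnegative and antitone,
this makes `w` the sequence of the first `finrank 𝕜 E` singular values of `T`
and `b` a basis of right singular vectors. The weights are indexed by `ℕ` to match
`LinearMap.singularValues`; only those with index below `n` matter. -/
def NormDiagonalizedBy {n : ℕ} (T : E →ₗ[𝕜] F) (b : OrthonormalBasis (Fin n) 𝕜 E)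
    (w : ℕ → ℝ) : Prop :=
  ∀ x, ‖T x‖ ^ 2 = ∑ i : Fin n, w i ^ 2 * ‖⟪b i, x⟫_𝕜‖ ^ 2

namespace NormDiagonalizedBy

variable {n : ℕ} {T : E →ₗ[𝕜] F} {b : OrthonormalBasis (Fin n) 𝕜 E} {w : ℕ → ℝ}

/-- Any subspace of dimension more than `k` meets the orthogonal complement of the first `k` basis
vectors, on which `T` stretches by at most `w k`. -/
theorem le_weight (h : T.NormDiagonalizedBy b w) (hw : Antitone w) (hw0 : ∀ i, 0 ≤ w i)
    {k : ℕ} {V : Submodule 𝕜 E} (hV : k < finrank 𝕜 V) {c : ℝ}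
    (hc : ∀ x ∈ V, c * ‖x‖ ≤ ‖T x‖) : c ≤ w k := by
  have hn : finrank 𝕜 E = n := by simpa using finrank_eq_card_basis b.toBasis
  have := b.toBasis.finiteDimensional_of_finite
  have hkn : k < n := hn ▸ hV.trans_le V.finrank_le
  let f : V →ₗ[𝕜] (Fin k → 𝕜) :=
    LinearMap.pi fun i ↦ (innerSL 𝕜 (b ⟨i, i.2.trans hkn⟩)).toLinearMap ∘ₗ V.subtype
  obtain ⟨x, hx, hx0⟩ := (Submodule.ne_bot_iff _).1
    (f.ker_ne_bot_of_finrank_lt (by simpa using hV))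
  have hxi (i : Fin n) (hi : (i : ℕ) < k) : ⟪b i, (x : E)⟫_𝕜 = 0 := by
    simpa [f] using congrFun (LinearMap.mem_ker.1 hx) ⟨i, hi⟩
  have hxpos : 0 < ‖(x : E)‖ := by simpa using hx0
  have hle : ‖T x‖ ^ 2 ≤ (w k * ‖(x : E)‖) ^ 2 := by
    rw [h, mul_pow, ← b.sum_sq_norm_inner_right, Finset.mul_sum]
    refine Finset.sum_le_sum fun i _ ↦ ?_
    rcases lt_or_ge (i : ℕ) k with hi | hi
    · simp [hxi i hi]
    · gcongr
      · exact hw0 _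
      · exact hw hi
  have := (hc x x.2).trans
    (le_of_sq_le_sq hle (mul_nonneg (hw0 k) hxpos.le))
  exact le_of_mul_le_mul_right this hxpos

/-- On the span of the first `k + 1` basis vectors `T` stretches by at least `w k`. -/
theorem exists_submodule (h : T.NormDiagonalizedBy b w) (hw : Antitone w) (hw0 : ∀ i, 0 ≤ w i)
    {k : ℕ} (hk : k < finrank 𝕜 E) :
    ∃ V : Submodule 𝕜 E, finrank 𝕜 V = k + 1 ∧ ∀ x ∈ V, w k * ‖x‖ ≤ ‖T x‖ := by
  have hn : finrank 𝕜 E = n := by simpa using finrank_eq_card_basis b.toBasis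
  let v : Fin (k + 1) → E := fun i ↦ b (Fin.castLE (by omega) i)
  have hv : LinearIndependent 𝕜 v :=
    b.orthonormal.linearIndependent.comp _ (Fin.castLE_injective _)
  refine ⟨Submodule.span 𝕜 (Set.range v), by simp [finrank_span_eq_card hv], fun x hx ↦ ?_⟩
  have hxi (i : Fin n) (hi : k < i) : ⟪b i, x⟫_𝕜 = 0 := by
    induction hx using Submodule.span_induction with
    | mem x hx =>
      obtain ⟨j, rfl⟩ := hx
      refine b.orthonormal.inner_eq_zero fun hij ↦ ?_
      have := congrArg Fin.val hij
      simp at this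
      omega
    | zero => simp
    | add x y _ _ hx hy => simp [inner_add_right, hx, hy]
    | smul a x _ hx => simp [inner_smul_right, hx]
  refine le_of_sq_le_sq ?_ (norm_nonneg _)
  rw [h, mul_pow, ← b.sum_sq_norm_inner_right, Finset.mul_sum]
  refine Finset.sum_le_sum fun i _ ↦ ?_
  rcases lt_or_ge k (i : ℕ) with hi | hi
  · simp [hxi i hi]
  · gcongr
    · exact hw0 _
    · exact hw hi

end NormDiagonalizedBy

variable [FiniteDimensional 𝕜 E] [FiniteDimensional 𝕜 F] [FiniteDimensional 𝕜 G]

theorem exists_normDiagonalizedBy_singularValues (T : E →ₗ[𝕜] F) :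
    ∃ b : OrthonormalBasis (Fin (finrank 𝕜 E)) 𝕜 E, T.NormDiagonalizedBy b T.singularValues := by
  have hT := T.isSymmetric_adjoint_comp_self
  refine ⟨hT.eigenvectorBasis rfl, fun x ↦ ?_⟩
  have h : ((‖T x‖ ^ 2 : ℝ) : 𝕜) = ⟪x, (adjoint T ∘ₗ T) x⟫_𝕜 := by
    simp [adjoint_inner_right]
  rw [← RCLike.ofReal_inj (K := 𝕜), h, ← (hT.eigenvectorBasis rfl).sum_inner_mul_inner]
  rw [RCLike.ofReal_sum]
  refine Finset.sum_congr rfl fun i _ ↦ ?_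
  push_cast [-coe_comp]
  rw [← (hT.eigenvectorBasis rfl).repr_apply_apply ((adjoint T ∘ₗ T) x),
    hT.eigenvectorBasis_apply_self_apply rfl,
    ← RCLike.ofReal_pow (T.singularValues i), T.sq_singularValues_fin rfl,
    OrthonormalBasis.repr_apply_apply, mul_left_comm, ← inner_conj_symm x, RCLike.conj_mul]

/-- One half of the Courant–Fischer max-min principle. -/
theorem le_singularValues_of_forall_mem (T : E →ₗ[𝕜] F) {k : ℕ} {V : Submodule 𝕜 E}
    (hV : k < finrank 𝕜 V) {c : ℝ} (hc : ∀ x ∈ V, c * ‖x‖ ≤ ‖T x‖) :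
    c ≤ T.singularValues k := by
  obtain ⟨b, hb⟩ := T.exists_normDiagonalizedBy_singularValues
  exact hb.le_weight T.singularValues_antitone T.singularValues_nonneg hV hc

/-- The other half of the Courant–Fischer max-min principle: the maximum is attained. -/
theorem exists_submodule_singularValues_mul_norm_le (T : E →ₗ[𝕜] F) {k : ℕ}
    (hk : k < finrank 𝕜 E) :
    ∃ V : Submodule 𝕜 E, finrank 𝕜 V = k + 1 ∧ ∀ x ∈ V, T.singularValues k * ‖x‖ ≤ ‖T x‖ := by
  obtain ⟨b, hb⟩ := T.exists_normDiagonalizedBy_singularValues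
  exact hb.exists_submodule T.singularValues_antitone T.singularValues_nonneg hk

theorem NormDiagonalizedBy.singularValues_eq {n : ℕ} {T : E →ₗ[𝕜] F}
    {b : OrthonormalBasis (Fin n) 𝕜 E} {w : ℕ → ℝ} (h : T.NormDiagonalizedBy b w)
    (hw : Antitone w) (hw0 : ∀ i, 0 ≤ w i) {k : ℕ} (hk : k < finrank 𝕜 E) :
    T.singularValues k = w k := by
  obtain ⟨V, hV, hTV⟩ := T.exists_submodule_singularValues_mul_norm_le hk
  obtain ⟨W, hW, hTW⟩ := h.exists_submodule hw hw0 hk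
  exact le_antisymm (h.le_weight hw hw0 (by omega) hTV)
    (T.le_singularValues_of_forall_mem (by omega) hTW)

/-! ### Monotonicity and invariance under adjoints -/

theorem mul_singularValues_le_of_mul_norm_le (S : E →ₗ[𝕜] F) (T : E →ₗ[𝕜] G) {c : ℝ}
    (hc : 0 ≤ c) (h : ∀ x, c * ‖S x‖ ≤ ‖T x‖) (k : ℕ) :
    c * S.singularValues k ≤ T.singularValues k := by
  rcases lt_or_ge k (finrank 𝕜 E) with hk | hk
  · obtain ⟨V, hV, hSV⟩ := S.exists_submodule_singularValues_mul_norm_le hk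
    refine T.le_singularValues_of_forall_mem (V := V) (by omega) fun x hx ↦ ?_
    calc c * S.singularValues k * ‖x‖ = c * (S.singularValues k * ‖x‖) := mul_assoc _ _ _
      _ ≤ c * ‖S x‖ := mul_le_mul_of_nonneg_left (hSV x hx) hc
      _ ≤ ‖T x‖ := h x
  · simp [singularValues_of_finrank_le _ hk]

theorem singularValues_le_of_norm_le (S : E →ₗ[𝕜] F) (T : E →ₗ[𝕜] G)
    (h : ∀ x, ‖S x‖ ≤ ‖T x‖) (k : ℕ) : S.singularValues k ≤ T.singularValues k := by
  simpa using S.mul_singularValues_le_of_mul_norm_le T zero_le_one (by simpa using h) k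

/-- If `T` stretches by at least `c` on `V`, then so does `T†` on the image of `V`, because
`‖T x‖ ^ 2 = ⟪T† (T x), x⟫ ≤ ‖T† (T x)‖ * ‖x‖`. -/
theorem singularValues_le_singularValues_adjoint (T : E →ₗ[𝕜] F) (k : ℕ) :
    T.singularValues k ≤ (adjoint T).singularValues k := by
  rcases (T.singularValues_nonneg k).eq_or_lt with h0 | h0
  · exact h0 ▸ singularValues_nonneg _ _
  have hk : k < finrank 𝕜 E := by
    by_contra! hk
    exact h0.ne' (T.singularValues_of_finrank_le hk)
  obtain ⟨V, hV, hTV⟩ := T.exists_submodule_singularValues_mul_norm_le hk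
  have hinj : Function.Injective (T.domRestrict V) := by
    refine (injective_iff_map_eq_zero _).2 fun x hx ↦ ?_
    have h1 := hTV x x.2
    rw [domRestrict_apply] at hx
    rw [hx, norm_zero] at h1
    have h2 : ‖(x : E)‖ ≤ 0 := by
      by_contra! h2
      exact (mul_pos h0 h2).not_ge h1
    simpa using h2
  refine (adjoint T).le_singularValues_of_forall_mem (V := range (T.domRestrict V))
    (by rw [finrank_range_of_inj hinj]; omega) ?_
  rintro _ ⟨x, rfl⟩
  rw [domRestrict_apply]
  have h1 := hTV x x.2
  rcases (norm_nonneg (x : E)).eq_or_lt with hx | hx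
  · have : (x : E) = 0 := by simpa using hx.symm
    simp [this]
  · have h2 : ‖T x‖ ^ 2 ≤ ‖adjoint T (T x)‖ * ‖(x : E)‖ := by
      have := norm_inner_le_norm (𝕜 := 𝕜) (adjoint T (T x)) (x : E)
      rwa [adjoint_inner_left, inner_self_eq_norm_sq_to_K, norm_pow, RCLike.norm_ofReal,
        abs_norm] at this
    refine le_of_mul_le_mul_right ?_ hx
    nlinarith [mul_le_mul_of_nonneg_right h1 (norm_nonneg (T x))]

@[simp]
theorem singularValues_adjoint (T : E →ₗ[𝕜] F) :
    (adjoint T).singularValues = T.singularValues := by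
  ext k
  refine le_antisymm ?_ (T.singularValues_le_singularValues_adjoint k)
  simpa using (adjoint T).singularValues_le_singularValues_adjoint k

theorem singularValues_comp_comm_adjoint (T : F →ₗ[𝕜] G) (S : E →ₗ[𝕜] F) :
    (T ∘ₗ S).singularValues = (adjoint S ∘ₗ adjoint T).singularValues := by
  rw [← adjoint_comp, singularValues_adjoint]

theorem singularValues_comp_of_finrank_le (T : F →ₗ[𝕜] G) (S : E →ₗ[𝕜] F) {k : ℕ}
    (hk : finrank 𝕜 F ≤ k) : (T ∘ₗ S).singularValues k = 0 := by
  rw [singularValues_eq_zero_iff_le_finrank_range, range_comp]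
  exact ((Submodule.finrank_map_le _ _).trans (Submodule.finrank_le _)).trans hk

/-! ### Replacing factors by endomorphisms -/

/-- An operator on the domain of `T` with the same right singular vectors as `T` whose singular
values are those of `T` raised to at least `t`. For `t = 0` it has the norms of `|T|`, for
`t > 0` it is an invertible operator dominating `T`. -/
theorem exists_endomorphism_singularValues_eq_max (T : E →ₗ[𝕜] F) {t : ℝ} (ht : 0 ≤ t) :
    ∃ P : E →ₗ[𝕜] E, (∀ k < finrank 𝕜 E, P.singularValues k = max (T.singularValues k) t) ∧
      (∀ x, ‖T x‖ ≤ ‖P x‖) ∧ (∀ x, t * ‖x‖ ≤ ‖P x‖) ∧ (t = 0 → ∀ x, ‖P x‖ = ‖T x‖) := by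
  obtain ⟨b, hb⟩ := T.exists_normDiagonalizedBy_singularValues
  let w : ℕ → ℝ := fun k ↦ max (T.singularValues k) t
  have hw : Antitone w := T.singularValues_antitone.max antitone_const
  have hw0 (k : ℕ) : 0 ≤ w k := le_max_of_le_right ht
  let P : E →ₗ[𝕜] E := b.toBasis.constr 𝕜 fun i ↦ (w i : 𝕜) • b i
  have hP : P.NormDiagonalizedBy b w := by
    intro x
    rw [← b.sum_sq_norm_inner_right]
    refine Finset.sum_congr rfl fun i _ ↦ ?_
    have : ⟪b i, P x⟫_𝕜 = w i * ⟪b i, x⟫_𝕜 := by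
      simp [P, Basis.constr_apply_fintype, inner_sum, inner_smul_right,
        OrthonormalBasis.repr_apply_apply, b.inner_eq_ite, mul_comm]
    rw [this, norm_mul, mul_pow, RCLike.norm_ofReal, sq_abs]
  refine ⟨P, fun k hk ↦ hP.singularValues_eq hw hw0 hk, fun x ↦ ?_, fun x ↦ ?_, ?_⟩
  · refine le_of_sq_le_sq ?_ (norm_nonneg _)
    rw [hb, hP]
    gcongr
    · exact T.singularValues_nonneg _
    · exact le_max_left _ _
  · refine le_of_sq_le_sq ?_ (norm_nonneg _)
    rw [hP, mul_pow, ← b.sum_sq_norm_inner_right, Finset.mul_sum]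
    gcongr
    exact le_max_right _ _
  · rintro rfl x
    refine (sq_eq_sq₀ (norm_nonneg _) (norm_nonneg _)).1 ?_
    rw [hb, hP]
    simp [w, T.singularValues_nonneg]

theorem prod_singularValues_comp_end (P Q : E →ₗ[𝕜] E) :
    ∏ i ∈ Finset.range (finrank 𝕜 E), (P ∘ₗ Q).singularValues i =
      (∏ i ∈ Finset.range (finrank 𝕜 E), P.singularValues i) *
        ∏ i ∈ Finset.range (finrank 𝕜 E), Q.singularValues i := by
  simp only [← normDet_eq_prod_singularValues]
  exact normDet_comp_of_finrank_eq _ _ rfl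

/-- Both factors may be replaced by operators on the middle space `F` that dominate `T` and `S†`. -/
theorem singularValues_comp_le_of_norm_le (T : F →ₗ[𝕜] G) (S : E →ₗ[𝕜] F) (P Q : F →ₗ[𝕜] F)
    (hP : ∀ x, ‖T x‖ ≤ ‖P x‖) (hQ : ∀ x, ‖adjoint S x‖ ≤ ‖Q x‖) (k : ℕ) :
    (T ∘ₗ S).singularValues k ≤ (P ∘ₗ adjoint Q).singularValues k := by
  calc (T ∘ₗ S).singularValues k ≤ (P ∘ₗ S).singularValues k :=
        singularValues_le_of_norm_le _ _ (fun x ↦ hP (S x)) k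
    _ = (adjoint S ∘ₗ adjoint P).singularValues k := by rw [singularValues_comp_comm_adjoint]
    _ ≤ (Q ∘ₗ adjoint P).singularValues k :=
        singularValues_le_of_norm_le _ _ (fun x ↦ hQ (adjoint P x)) k
    _ = (P ∘ₗ adjoint Q).singularValues k := by
        rw [singularValues_comp_comm_adjoint, adjoint_adjoint]

theorem singularValues_comp_eq_of_norm_eq (T : F →ₗ[𝕜] G) (S : E →ₗ[𝕜] F) (P Q : F →ₗ[𝕜] F)
    (hP : ∀ x, ‖P x‖ = ‖T x‖) (hQ : ∀ x, ‖Q x‖ = ‖adjoint S x‖) (k : ℕ) :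
    (T ∘ₗ S).singularValues k = (P ∘ₗ adjoint Q).singularValues k := by
  refine le_antisymm (singularValues_comp_le_of_norm_le T S P Q (fun x ↦ (hP x).ge)
    (fun x ↦ (hQ x).ge) k) ?_
  calc (P ∘ₗ adjoint Q).singularValues k ≤ (T ∘ₗ adjoint Q).singularValues k :=
        singularValues_le_of_norm_le _ _ (fun x ↦ (hP (adjoint Q x)).le) k
    _ = (Q ∘ₗ adjoint T).singularValues k := by
        rw [singularValues_comp_comm_adjoint, adjoint_adjoint]
    _ ≤ (adjoint S ∘ₗ adjoint T).singularValues k :=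
        singularValues_le_of_norm_le _ _ (fun x ↦ (hQ (adjoint T x)).le) k
    _ = (T ∘ₗ S).singularValues k := by rw [singularValues_comp_comm_adjoint T S]

/-- The Cauchy–Binet identity for a factorization through a space whose dimension is the number of
singular values taken. -/
theorem prod_singularValues_comp (T : F →ₗ[𝕜] G) (S : E →ₗ[𝕜] F) :
    ∏ i ∈ Finset.range (finrank 𝕜 F), (T ∘ₗ S).singularValues i =
      (∏ i ∈ Finset.range (finrank 𝕜 F), T.singularValues i) *
        ∏ i ∈ Finset.range (finrank 𝕜 F), S.singularValues i := by
  obtain ⟨P, hPs, -, -, hP⟩ := T.exists_endomorphism_singularValues_eq_max le_rfl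
  obtain ⟨Q, hQs, -, -, hQ⟩ := (adjoint S).exists_endomorphism_singularValues_eq_max le_rfl
  simp only [singularValues_comp_eq_of_norm_eq T S P Q (hP rfl) (hQ rfl)]
  rw [prod_singularValues_comp_end, singularValues_adjoint]
  congr 1 <;> refine Finset.prod_congr rfl fun i hi ↦ ?_
  · rw [hPs i (Finset.mem_range.1 hi), max_eq_left (T.singularValues_nonneg i)]
  · rw [hQs i (Finset.mem_range.1 hi), singularValues_adjoint,
      max_eq_left (S.singularValues_nonneg i)]

/-! ### The Gel'fand–Naimark inequality -/

/-- The Gel'fand–Naimark inequality with all singular values raised to positive levels `t` and `ε`.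
The operators `P`, `Q` dominating `T`, `S†` are invertible, and `s_i (P Q†) / (t s_i (Q)) ≥ 1` for
every `i`, so the product of these ratios over `I` is at most the product over all `i`, which is a
quotient of determinants. The ratio `max (s_j (T)) t / t` equals `1` for `j ≥ #I`. -/
theorem prod_singularValues_comp_le_of_pos (T : F →ₗ[𝕜] G) (S : E →ₗ[𝕜] F) {I : Finset ℕ}
    (hI : I ⊆ Finset.range (finrank 𝕜 F)) {t ε : ℝ} (ht : 0 < t) (hε : 0 < ε)
    (hT : ∀ j, I.card ≤ j → T.singularValues j ≤ t) :
    ∏ i ∈ I, (T ∘ₗ S).singularValues i ≤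
      (∏ j ∈ Finset.range I.card, max (T.singularValues j) t) *
        ∏ i ∈ I, max (S.singularValues i) ε := by
  set n := finrank 𝕜 F
  obtain ⟨P, hPs, hP, hPt, -⟩ := T.exists_endomorphism_singularValues_eq_max ht.le
  obtain ⟨Q, hQs, hQ, -, -⟩ := (adjoint S).exists_endomorphism_singularValues_eq_max hε.le
  rw [singularValues_adjoint] at hQs
  have hcard : I.card ≤ n := by simpa using Finset.card_le_card hI
  let q : ℕ → ℝ := fun i ↦ max (S.singularValues i) ε
  have hq (i : ℕ) : 0 < q i := lt_max_of_lt_right hε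
  let R : ℕ → ℝ := fun i ↦ (P ∘ₗ adjoint Q).singularValues i
  have hR0 (i : ℕ) : 0 ≤ R i := singularValues_nonneg _ _
  have hR (i : ℕ) (hi : i < n) : t * q i ≤ R i := by
    have := mul_singularValues_le_of_mul_norm_le (adjoint Q) (P ∘ₗ adjoint Q) ht.le
      (fun x ↦ hPt (adjoint Q x)) i
    rwa [singularValues_adjoint, hQs i hi] at this
  have hdet : ∏ i ∈ Finset.range n, R i =
      (∏ j ∈ Finset.range n, max (T.singularValues j) t) * ∏ i ∈ Finset.range n, q i := by
    rw [prod_singularValues_comp_end, singularValues_adjoint]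
    congr 1 <;> refine Finset.prod_congr rfl fun i hi ↦ ?_
    · exact hPs i (Finset.mem_range.1 hi)
    · exact hQs i (Finset.mem_range.1 hi)
  have htail : ∏ j ∈ Finset.range n, max (T.singularValues j) t =
      (∏ j ∈ Finset.range I.card, max (T.singularValues j) t) * t ^ (n - I.card) := by
    rw [← Finset.prod_range_mul_prod_Ico _ hcard]
    congr 1
    rw [Finset.prod_congr rfl fun j hj ↦ max_eq_right (hT j (Finset.mem_Ico.1 hj).1)]
    simp
  have hcompl : t ^ (n - I.card) * ∏ i ∈ Finset.range n \ I, q i ≤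
      ∏ i ∈ Finset.range n \ I, R i := by
    calc t ^ (n - I.card) * ∏ i ∈ Finset.range n \ I, q i
        = ∏ i ∈ Finset.range n \ I, t * q i := by
          rw [Finset.prod_mul_distrib, Finset.prod_const, Finset.card_sdiff_of_subset hI,
            Finset.card_range]
      _ ≤ _ := Finset.prod_le_prod (fun i _ ↦ (mul_pos ht (hq i)).le) fun i hi ↦
          hR i (Finset.mem_range.1 (Finset.mem_sdiff.1 hi).1)
  calc ∏ i ∈ I, (T ∘ₗ S).singularValues i ≤ ∏ i ∈ I, R i :=
        Finset.prod_le_prod (fun i _ ↦ singularValues_nonneg _ _) fun i _ ↦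
          singularValues_comp_le_of_norm_le T S P Q hP hQ i
    _ ≤ _ := by
        have hpos : 0 < t ^ (n - I.card) * ∏ i ∈ Finset.range n \ I, q i :=
          mul_pos (pow_pos ht _) (Finset.prod_pos fun i _ ↦ hq i)
        refine le_of_mul_le_mul_left ?_ hpos
        calc _ ≤ (∏ i ∈ Finset.range n \ I, R i) * ∏ i ∈ I, R i :=
              mul_le_mul_of_nonneg_right hcompl (Finset.prod_nonneg fun i _ ↦ hR0 i)
          _ = _ := by
              rw [Finset.prod_sdiff hI, hdet, htail, ← Finset.prod_sdiff hI]
              ring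

/-- The **Gel'fand–Naimark inequality** for the singular values of a composition. -/
theorem prod_singularValues_comp_le (T : F →ₗ[𝕜] G) (S : E →ₗ[𝕜] F) (I : Finset ℕ) :
    ∏ i ∈ I, (T ∘ₗ S).singularValues i ≤
      (∏ j ∈ Finset.range I.card, T.singularValues j) * ∏ i ∈ I, S.singularValues i := by
  by_cases hI : I ⊆ Finset.range (finrank 𝕜 F)
  · -- Raising to the level `s_{#I - 1} (T)` leaves `s_j (T)` unchanged for `j < #I`; the summand `ε`
    -- makes the level positive. For empty `I` the index truncates to `0`, and `s_0 (T)` bounds all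
    -- `s_j (T)`, as needed.
    let t : ℝ → ℝ := fun ε ↦ T.singularValues (I.card - 1) + ε
    let f : ℝ → ℝ := fun ε ↦ (∏ j ∈ Finset.range I.card, max (T.singularValues j) (t ε)) *
      ∏ i ∈ I, max (S.singularValues i) ε
    have hf : Continuous f := by fun_prop
    have hf0 : f 0 =
        (∏ j ∈ Finset.range I.card, T.singularValues j) * ∏ i ∈ I, S.singularValues i := by
      simp only [f, t, add_zero]
      congr 1 <;> refine Finset.prod_congr rfl fun i hi ↦ max_eq_left ?_
      · exact T.singularValues_antitone (by have := Finset.mem_range.1 hi; omega)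
      · exact S.singularValues_nonneg i
    rw [← hf0]
    refine ge_of_tendsto
      ((hf.tendsto 0).mono_left (nhdsWithin_le_nhds (s := Set.Ioi 0))) ?_
    filter_upwards [self_mem_nhdsWithin] with ε (hε : 0 < ε)
    refine prod_singularValues_comp_le_of_pos T S hI
      (add_pos_of_nonneg_of_pos (T.singularValues_nonneg _) hε) hε fun j hj ↦ ?_
    exact (T.singularValues_antitone (by omega)).trans (le_add_of_nonneg_right hε.le)
  · -- an index beyond the dimension of the middle space makes the left side vanish
    obtain ⟨i, hiI, hi⟩ := Finset.not_subset.1 hI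
    rw [Finset.prod_eq_zero hiI
      (singularValues_comp_of_finrank_le T S (by simpa using hi))]
    exact mul_nonneg (Finset.prod_nonneg fun i _ ↦ T.singularValues_nonneg i)
      (Finset.prod_nonneg fun i _ ↦ S.singularValues_nonneg i)

/-- The three-factor form of the Gel'fand–Naimark inequality: peel off `T` from the left and, after
passing to adjoints, `U` from the right. -/
theorem prod_singularValues_comp_comp_le {H : Type*} [NormedAddCommGroup H]
    [InnerProductSpace 𝕜 H] [FiniteDimensional 𝕜 H]
    (T : F →ₗ[𝕜] G) (S : E →ₗ[𝕜] F) (U : H →ₗ[𝕜] E) (I : Finset ℕ) :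
    ∏ i ∈ I, (T ∘ₗ S ∘ₗ U).singularValues i ≤
      (∏ j ∈ Finset.range I.card, T.singularValues j * U.singularValues j) *
        ∏ i ∈ I, S.singularValues i := by
  have h := prod_singularValues_comp_le (adjoint U) (adjoint S) I
  rw [← singularValues_comp_comm_adjoint, singularValues_adjoint, singularValues_adjoint] at h
  calc _ ≤ _ := prod_singularValues_comp_le T (S ∘ₗ U) I
    _ ≤ _ := mul_le_mul_of_nonneg_left h (Finset.prod_nonneg fun i _ ↦ T.singularValues_nonneg i)
    _ = _ := by rw [Finset.prod_mul_distrib, mul_assoc]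

end

end LinearMap

/-! ### Matrices -/

theorem theorem5p4 {𝕜 : Type*} [RCLike 𝕜] {p q r s : ℕ}
    (A : Matrix (Fin p) (Fin q) 𝕜) (B : Matrix (Fin q) (Fin r) 𝕜) (C : Matrix (Fin r) (Fin s) 𝕜)
    (n : ℕ) (hq : q ≤ n) (hr : r ≤ n) :
    LogSubMajorized
      (paddedSingularValues (A * B * C) n)
      (paddedSingularValues B n)
      (fun i => paddedSingularValues A n i * paddedSingularValues C n i) := by
  have hABC : (A * B * C).toEuclideanLin =
      A.toEuclideanLin ∘ₗ B.toEuclideanLin ∘ₗ C.toEuclideanLin := by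
    rw [Matrix.mul_assoc, Matrix.toLpLin_mul _ 2, Matrix.toLpLin_mul _ 2]
  constructor
  · intro k _ hkn i hi
    have hinj : Function.Injective fun j ↦ (i j : ℕ) := Fin.val_injective.comp hi.injective
    have h := LinearMap.prod_singularValues_comp_comp_le A.toEuclideanLin B.toEuclideanLin
      C.toEuclideanLin (Finset.univ.image fun j ↦ (i j : ℕ))
    rw [Finset.card_image_of_injective _ hinj, Finset.prod_image hinj.injOn,
      Finset.prod_image hinj.injOn, Finset.card_univ, Fintype.card_fin, ← hABC,
      ← Fin.prod_univ_eq_prod_range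
        fun j ↦ A.toEuclideanLin.singularValues j * C.toEuclideanLin.singularValues j,
      ← Finset.prod_mul_distrib] at h
    exact h
  · simp only [paddedSingularValues, hABC]
    rw [Fin.prod_univ_eq_prod_range fun j ↦ (A.toEuclideanLin ∘ₗ B.toEuclideanLin ∘ₗ
        C.toEuclideanLin).singularValues j,
      Fin.prod_univ_eq_prod_range fun j ↦ A.toEuclideanLin.singularValues j *
        C.toEuclideanLin.singularValues j * B.toEuclideanLin.singularValues j]
    by_cases hn : q = n ∧ r = n
    · obtain ⟨rfl, rfl⟩ := hn
      have h1 := LinearMap.prod_singularValues_comp A.toEuclideanLin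
        (B.toEuclideanLin ∘ₗ C.toEuclideanLin)
      have h2 := LinearMap.prod_singularValues_comp B.toEuclideanLin C.toEuclideanLin
      rw [finrank_euclideanSpace_fin] at h1 h2
      rw [h1, h2, Finset.prod_mul_distrib, Finset.prod_mul_distrib]
      ring
    · -- if `B` is not square of size `n`, its rank is below `n` and the last factors vanish
      have hmem : n - 1 ∈ Finset.range n := Finset.mem_range.2 (by omega)
      obtain h | h : q ≤ n - 1 ∨ r ≤ n - 1 := by omega
      · rw [Finset.prod_eq_zero hmem (LinearMap.singularValues_comp_of_finrank_le _ _ (by simpa)),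
          Finset.prod_eq_zero hmem]
        rw [LinearMap.singularValues_of_finrank_le A.toEuclideanLin (by simpa), zero_mul, zero_mul]
      · rw [← LinearMap.comp_assoc, Finset.prod_eq_zero hmem
            (LinearMap.singularValues_comp_of_finrank_le _ C.toEuclideanLin (by simpa)),
          Finset.prod_eq_zero hmem]
        rw [LinearMap.singularValues_of_finrank_le B.toEuclideanLin (by simpa), mul_zero]
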